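/- **Lemma 2.3 (compact embedding).** Fix $c>0$ and let $$\mathscr Z=\left\{u\in L^2(\mathbb R^2):\ D_x^{1/2}u,\ D_x^{-1/2}u_y\in L^2(\mathbb R^2)\right\},\qquad \|u\|_{\mathscr Z}=\left(\int_{\mathbb R^2}\left(c|u|^2+|D_x^{1/2}u|^2+|D_x^{-1/2}u_y|^2\right)dx\,dy\right)^{1/2},$$ where the functions are real-valued or complex-valued and, with $\widehat u(\xi,\eta)$ denoting the Fourier transform in the (angular) frequency variables $(\xi,\eta)$, the functions $D_x^{1/2}u$ and $D_x^{-1/2}u_y$ are those whose Fourier transforms are $|\xi|^{1/2}\widehat u$ and $|\xi|^{-1/2}\,i\eta\,\widehat u$. Let $L^{q}_{loc}(\mathbb R^2)$ be the space of (classes of) measurable functions that belong to $L^q(K)$ for every compact $K\subset\mathbb R^2$, with the topology of convergence in $L^q(K)$ for every such $K$. If $0\le p<2$, then $\mathscr Z\subset L^{p+2}_{loc}(\mathbb R^2)$, and the inclusion $\mathscr Z\hookrightarrow L^{p+2}_{loc}(\mathbb R^2)$ is a continuous and compact operator, i.e. it maps some neighbourhood of $0$ (equivalently, every bounded set) of $\mathscr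 Z$ into a compact subset of $L^{p+2}_{loc}(\mathbb R^2)$. -/

import Mathlib

open MeasureTheory
open scoped FourierTransform ENNReal

noncomputable section

namespace ShriraSpace

/-- The plane `ℝ²` with its Euclidean structure; the coordinate `0` is `x` (frequency `ξ`), the
coordinate `1` is `y` (frequency `η`). -/
abbrev Plane : Type := EuclideanSpace ℝ (Fin 2)

/-! ### Fourier multipliers on `L²(ℝ²; ℂ)`

The Fourier transform on `L²` is the unitary one with kernel `exp (-2πi ⟨x, ζ⟩)`. The usual
(angular) frequency variables are hence `2π ζ₀` and `2π ζ₁`. -/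

theorem multiplier_add_aux (m : Plane → ℂ) (u v : Lp ℂ 2 (volume : Measure Plane)) :
    (fun ζ => m ζ * (𝓕 u : Lp ℂ 2 (volume : Measure Plane)) ζ) +
      (fun ζ => m ζ * (𝓕 v : Lp ℂ 2 (volume : Measure Plane)) ζ) =ᵐ[volume]
    fun ζ => m ζ * (𝓕 (u + v) : Lp ℂ 2 (volume : Measure Plane)) ζ := by
  rw [FourierTransform.fourier_add]
  filter_upwards [Lp.coeFn_add (𝓕 u : Lp ℂ 2 (volume : Measure Plane)) (𝓕 v)] with ζ hζ
  rw [hζ, Pi.add_apply, Pi.add_apply, mul_add]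

theorem multiplier_smul_aux (m : Plane → ℂ) (a : ℂ) (u : Lp ℂ 2 (volume : Measure Plane)) :
    a • (fun ζ => m ζ * (𝓕 u : Lp ℂ 2 (volume : Measure Plane)) ζ) =ᵐ[volume]
    fun ζ => m ζ * (𝓕 (a • u) : Lp ℂ 2 (volume : Measure Plane)) ζ := by
  rw [FourierTransform.fourier_smul]
  filter_upwards [Lp.coeFn_smul a (𝓕 u : Lp ℂ 2 (volume : Measure Plane))] with ζ hζ
  rw [hζ, Pi.smul_apply, Pi.smul_apply, mul_smul_comm]

/-- The domain of `m(D)` in `L²`: those `u` for which `m · û` is square integrable. -/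
def multiplierDomain (m : Plane → ℂ) : Submodule ℂ (Lp ℂ 2 (volume : Measure Plane)) where
  carrier := {u | MemLp (fun ζ => m ζ * (𝓕 u : Lp ℂ 2 (volume : Measure Plane)) ζ) 2 volume}
  zero_mem' := by
    refine (MemLp.zero' (ε := ℂ)).ae_eq ?_
    have h : (𝓕 (0 : Lp ℂ 2 (volume : Measure Plane)) : Lp ℂ 2 (volume : Measure Plane)) = 0 :=
      map_zero (Lp.fourierTransformₗᵢ Plane ℂ)
    rw [h]
    filter_upwards [Lp.coeFn_zero ℂ 2 (volume : Measure Plane)] with ζ hζ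
    rw [hζ, Pi.zero_apply, mul_zero]
  add_mem' {u v} hu hv := (MemLp.add hu hv).ae_eq (multiplier_add_aux m u v)
  smul_mem' a u hu := (MemLp.const_smul hu a).ae_eq (multiplier_smul_aux m a u)

/-- `m(D)`: the function `m(D) u ∈ L²` has the Fourier transform `m · û`. -/
def multiplier (m : Plane → ℂ) : multiplierDomain m →ₗ[ℂ] Lp ℂ 2 (volume : Measure Plane) where
  toFun u := 𝓕⁻ (MemLp.toLp _ u.2 : Lp ℂ 2 (volume : Measure Plane))
  map_add' u v := by
    rw [← FourierTransform.fourierInv_add]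
    exact congrArg _ ((MemLp.toLp_eq_toLp_iff _ (u.2.add v.2)).2
      (multiplier_add_aux m u v).symm)
  map_smul' a u := by
    rw [RingHom.id_apply, ← FourierTransform.fourierInv_smul]
    exact congrArg _ ((MemLp.toLp_eq_toLp_iff _ (u.2.const_smul a)).2
      (multiplier_smul_aux m a u).symm)

/-- The symbol `|ξ|^{1/2}` of `D_x^{1/2}`, where `ξ = 2π ζ₀`. -/
def symbDx (ζ : Plane) : ℂ := ((|2 * Real.pi * ζ 0| ^ (1 / 2 : ℝ) : ℝ) : ℂ)

/-- The symbol `|ξ|^{-1/2} · iη` of `D_x^{-1/2} ∂_y`, where `ξ = 2π ζ₀` and `η = 2π ζ₁`. It takes a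
junk value on the null set `ξ = 0` only. -/
def symbDy (ζ : Plane) : ℂ :=
  ((|2 * Real.pi * ζ 0| ^ (-(1 / 2) : ℝ) : ℝ) : ℂ) *
    (Complex.I * ((2 * Real.pi * ζ 1 : ℝ) : ℂ))

/-- The map `v ↦ (f v, g v, h v)` into a Hilbert sum. -/
def hilbertSum {V E F G : Type*} [AddCommGroup V] [Module ℝ V] [NormedAddCommGroup E]
    [NormedSpace ℝ E] [NormedAddCommGroup F] [NormedSpace ℝ F] [NormedAddCommGroup G]
    [NormedSpace ℝ G] (f : V →ₗ[ℝ] E) (g : V →ₗ[ℝ] F) (h : V →ₗ[ℝ] G) :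
    V →ₗ[ℝ] WithLp 2 (E × WithLp 2 (F × G)) :=
  (WithLp.linearEquiv 2 ℝ _).symm.toLinearMap ∘ₗ
    f.prod ((WithLp.linearEquiv 2 ℝ _).symm.toLinearMap ∘ₗ g.prod h)

theorem hilbertSum_norm_sq {V E F G : Type*} [AddCommGroup V] [Module ℝ V] [NormedAddCommGroup E]
    [NormedSpace ℝ E] [NormedAddCommGroup F] [NormedSpace ℝ F] [NormedAddCommGroup G]
    [NormedSpace ℝ G] (f : V →ₗ[ℝ] E) (g : V →ₗ[ℝ] F) (h : V →ₗ[ℝ] G) (v : V) :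
    ‖hilbertSum f g h v‖ ^ 2 = ‖f v‖ ^ 2 + ‖g v‖ ^ 2 + ‖h v‖ ^ 2 := by
  rw [WithLp.prod_norm_sq_eq_of_L2, WithLp.prod_norm_sq_eq_of_L2, add_assoc]
  rfl

variable (𝕜 : Type*) [RCLike 𝕜]

/-- A `𝕜`-valued `L²` function seen as a complex-valued one (`𝕜` is `ℝ` or `ℂ`, and
`RCLike.map 𝕜 ℂ` is the inclusion `ℝ → ℂ`, respectively the identity). -/
def toComplex : Lp 𝕜 2 (volume : Measure Plane) →L[ℝ] Lp ℂ 2 (volume : Measure Plane) :=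
  (RCLike.map 𝕜 ℂ).compLpL 2 volume

/-! ### The energy space -/

/-- The `L²` functions `u` with `D_x^{1/2} u ∈ L²` and `D_x^{-1/2} u_y ∈ L²`, as a real vector
space. -/
def energySubmodule : Submodule ℝ (Lp 𝕜 2 (volume : Measure Plane)) :=
  ((multiplierDomain symbDx ⊓ multiplierDomain symbDy).restrictScalars ℝ).comap
    (toComplex 𝕜).toLinearMap

/-- `u ↦ D_x^{1/2} u`. -/
def halfDx : energySubmodule 𝕜 →ₗ[ℝ] Lp ℂ 2 (volume : Measure Plane) where
  toFun u := multiplier symbDx ⟨toComplex 𝕜 u, u.2.1⟩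
  map_add' u v := by
    rw [← map_add]
    exact congrArg _ (Subtype.ext (map_add (toComplex 𝕜) _ _))
  map_smul' a u := by
    rw [RingHom.id_apply, ← LinearMap.map_smul_of_tower]
    exact congrArg _ (Subtype.ext (map_smul (toComplex 𝕜) a _))

/-- `u ↦ D_x^{-1/2} u_y`. -/
def negHalfDxDy : energySubmodule 𝕜 →ₗ[ℝ] Lp ℂ 2 (volume : Measure Plane) where
  toFun u := multiplier symbDy ⟨toComplex 𝕜 u, u.2.2⟩
  map_add' u v := by
    rw [← map_add]
    exact congrArg _ (Subtype.ext (map_add (toComplex 𝕜) _ _))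
  map_smul' a u := by
    rw [RingHom.id_apply, ← LinearMap.map_smul_of_tower]
    exact congrArg _ (Subtype.ext (map_smul (toComplex 𝕜) a _))

/-- The map `u ↦ (√c u, D_x^{1/2} u, D_x^{-1/2} u_y)` into the Hilbert sum `L² ⊕ L² ⊕ L²`. -/
def energyMap (c : ℝ) : energySubmodule 𝕜 →ₗ[ℝ]
    WithLp 2 (Lp 𝕜 2 (volume : Measure Plane) ×
      WithLp 2 (Lp ℂ 2 (volume : Measure Plane) × Lp ℂ 2 (volume : Measure Plane))) :=
  hilbertSum (Real.sqrt c • (energySubmodule 𝕜).subtype) (halfDx 𝕜) (negHalfDxDy 𝕜)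

theorem energyMap_norm_sq {c : ℝ} (hc : 0 < c) (u : energySubmodule 𝕜) :
    ‖energyMap 𝕜 c u‖ ^ 2 = c * ‖(u : Lp 𝕜 2 (volume : Measure Plane))‖ ^ 2 +
      ‖halfDx 𝕜 u‖ ^ 2 + ‖negHalfDxDy 𝕜 u‖ ^ 2 := by
  have h1 : ‖(Real.sqrt c • (energySubmodule 𝕜).subtype) u‖ ^ 2 =
      c * ‖(u : Lp 𝕜 2 (volume : Measure Plane))‖ ^ 2 := by
    rw [LinearMap.smul_apply, norm_smul, mul_pow, Real.norm_eq_abs, sq_abs, Real.sq_sqrt hc.le]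
    rfl
  have h2 := hilbertSum_norm_sq (Real.sqrt c • (energySubmodule 𝕜).subtype) (halfDx 𝕜)
    (negHalfDxDy 𝕜) u
  rw [h1] at h2
  exact h2

theorem energyMap_injective {c : ℝ} (hc : 0 < c) : Function.Injective (energyMap 𝕜 c) := by
  refine (injective_iff_map_eq_zero _).2 fun u hu => ?_
  have h := energyMap_norm_sq 𝕜 hc u
  rw [hu, norm_zero] at h
  have h1 : ‖(u : Lp 𝕜 2 (volume : Measure Plane))‖ ^ 2 = 0 := by
    nlinarith [sq_nonneg ‖halfDx 𝕜 u‖, sq_nonneg ‖negHalfDxDy 𝕜 u‖,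
      sq_nonneg ‖(u : Lp 𝕜 2 (volume : Measure Plane))‖]
  exact Subtype.ext (norm_eq_zero.1 (pow_eq_zero_iff two_ne_zero |>.1 h1))

/-- The space `𝒵` of `𝕜`-valued functions, with wave speed `c > 0` entering its norm. (A type of its
own, so that it does not inherit the `L²` norm.) -/
def EnergySpace (c : ℝ) (_hc : 0 < c) : Type _ := energySubmodule 𝕜

variable {𝕜}

namespace EnergySpace

variable {c : ℝ} {hc : 0 < c}

instance : AddCommGroup (EnergySpace 𝕜 c hc) := inferInstanceAs (AddCommGroup (energySubmodule 𝕜))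

instance : Module ℝ (EnergySpace 𝕜 c hc) := inferInstanceAs (Module ℝ (energySubmodule 𝕜))

/-- The identity map onto the underlying vector space of functions. -/
def toSubmodule : EnergySpace 𝕜 c hc ≃ₗ[ℝ] energySubmodule 𝕜 := LinearEquiv.refl ℝ _

/-- `‖u‖² = ∫ c|u|² + |D_x^{1/2} u|² + |D_x^{-1/2} u_y|²`, see `EnergySpace.norm_sq_eq`. -/
instance : NormedAddCommGroup (EnergySpace 𝕜 c hc) :=
  NormedAddCommGroup.induced (EnergySpace 𝕜 c hc) _
    (energyMap 𝕜 c ∘ₗ toSubmodule.toLinearMap)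
    ((energyMap_injective 𝕜 hc).comp toSubmodule.injective)

instance : NormedSpace ℝ (EnergySpace 𝕜 c hc) :=
  NormedSpace.induced ℝ (EnergySpace 𝕜 c hc) _ (energyMap 𝕜 c ∘ₗ toSubmodule.toLinearMap)

/-- The `L²` function underlying an element of the space. -/
def toL2 (u : EnergySpace 𝕜 c hc) : Lp 𝕜 2 (volume : Measure Plane) := (toSubmodule u).1

theorem L2_norm_sq {F : Type*} [NormedAddCommGroup F] (f : Lp F 2 (volume : Measure Plane)) :
    ‖f‖ ^ 2 = ∫ x, ‖f x‖ ^ 2 := by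
  have h := (Lp.memLp f).eLpNorm_eq_integral_rpow_norm (by norm_num) (by norm_num)
  rw [Lp.norm_def, h, ENNReal.toReal_ofReal (by positivity)]
  simp only [ENNReal.toReal_ofNat, Real.rpow_two]
  rw [← Real.rpow_natCast, ← Real.rpow_mul (by positivity)]
  norm_num

theorem L2_sq_integrable {F : Type*} [NormedAddCommGroup F]
    (f : Lp F 2 (volume : Measure Plane)) : Integrable (fun x => ‖f x‖ ^ 2) volume :=
  (Lp.memLp f).integrable_norm_pow (by norm_num)

theorem norm_sq_eq_add (u : EnergySpace 𝕜 c hc) :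
    ‖u‖ ^ 2 = c * ‖u.toL2‖ ^ 2 + ‖halfDx 𝕜 (toSubmodule u)‖ ^ 2
      + ‖negHalfDxDy 𝕜 (toSubmodule u)‖ ^ 2 :=
  energyMap_norm_sq 𝕜 hc (toSubmodule u)

theorem norm_sq_eq (u : EnergySpace 𝕜 c hc) :
    ‖u‖ ^ 2 = ∫ x, (c * ‖u.toL2 x‖ ^ 2 + ‖halfDx 𝕜 (toSubmodule u) x‖ ^ 2
      + ‖negHalfDxDy 𝕜 (toSubmodule u) x‖ ^ 2) := by
  have i1 := (L2_sq_integrable u.toL2).const_mul c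
  have i2 := L2_sq_integrable (halfDx 𝕜 (toSubmodule u))
  have i12 : Integrable (fun x => c * ‖u.toL2 x‖ ^ 2 + ‖halfDx 𝕜 (toSubmodule u) x‖ ^ 2) volume :=
    i1.add i2
  rw [integral_add i12 (L2_sq_integrable _), integral_add i1 i2,
    integral_const_mul, ← L2_norm_sq, ← L2_norm_sq, ← L2_norm_sq, norm_sq_eq_add]

end EnergySpace

/-! ### The space `L^q_loc(ℝ²)` -/

variable (𝕜)

/-- Classes (modulo a.e. equality) of measurable functions on the plane which are in `L^q(K)` for
every compact set `K`. -/
def lpLocSubmodule (q : ℝ≥0∞) : Submodule ℝ (Plane →ₘ[volume] 𝕜) where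
  carrier := {f | ∀ K : Set Plane, IsCompact K → MemLp f q (volume.restrict K)}
  zero_mem' _ _ := (MemLp.zero' (ε := 𝕜)).ae_eq
    (ae_restrict_of_ae (AEEqFun.coeFn_zero (α := Plane) (μ := volume) (β := 𝕜)).symm)
  add_mem' {f g} hf hg K hK := ((hf K hK).add (hg K hK)).ae_eq
    (ae_restrict_of_ae (AEEqFun.coeFn_add f g).symm)
  smul_mem' a f hf K hK := ((hf K hK).const_smul a).ae_eq
    (ae_restrict_of_ae (AEEqFun.coeFn_smul a f).symm)

/-- The space `L^q_loc(ℝ²)`. -/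
def LpLoc (q : ℝ≥0∞) : Type _ := lpLocSubmodule 𝕜 q

variable {𝕜}

namespace LpLoc

instance (q : ℝ≥0∞) : AddCommGroup (LpLoc 𝕜 q) :=
  inferInstanceAs (AddCommGroup (lpLocSubmodule 𝕜 q))

instance (q : ℝ≥0∞) : Module ℝ (LpLoc 𝕜 q) := inferInstanceAs (Module ℝ (lpLocSubmodule 𝕜 q))

/-- The identity map onto the underlying vector space of (classes of) functions. -/
def toSubmodule {q : ℝ≥0∞} : LpLoc 𝕜 q ≃ₗ[ℝ] lpLocSubmodule 𝕜 q := LinearEquiv.refl ℝ _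

/-- The class of functions underlying an element of `L^q_loc`. -/
def toAEEqFun {q : ℝ≥0∞} (f : LpLoc 𝕜 q) : Plane →ₘ[volume] 𝕜 := (toSubmodule f).1

/-- Restriction of `L^q_loc` functions to a compact set `K`, with values in `L^q(K)`. -/
def restrict {q : ℝ≥0∞} (K : {K : Set Plane // IsCompact K}) :
    LpLoc 𝕜 q →ₗ[ℝ] Lp 𝕜 q (volume.restrict (K : Set Plane)) where
  toFun f := MemLp.toLp f.toAEEqFun ((toSubmodule f).2 K K.2)
  map_add' f g := (MemLp.toLp_eq_toLp_iff _ (((toSubmodule f).2 K K.2).add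
    ((toSubmodule g).2 K K.2))).2 (ae_restrict_of_ae (AEEqFun.coeFn_add _ _))
  map_smul' a f := (MemLp.toLp_eq_toLp_iff _ (((toSubmodule f).2 K K.2).const_smul a)).2
    (ae_restrict_of_ae (AEEqFun.coeFn_smul a _))

/-- The topology of `L^q` convergence on every compact set. -/
instance (q : ℝ≥0∞) [Fact (1 ≤ q)] : TopologicalSpace (LpLoc 𝕜 q) :=
  ⨅ K : {K : Set Plane // IsCompact K}, TopologicalSpace.induced (restrict K) inferInstance

end LpLoc

instance fact_one_le_add_two (a : ℝ≥0∞) : Fact (1 ≤ a + 2) :=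
  ⟨le_add_left one_le_two⟩

end ShriraSpace

end

/-! Write `a = |ξ|` and `b = |η|`. By AM-GM, `a + b² / a ≥ 2 b`, so the energy norm controls the
weight `1 + |ζ|` on the Fourier side: the space embeds in the isotropic `H^{1/2}` of the plane,
whose critical exponent is 4, and `q = p + 2 < 4` is subcritical.

Cut frequencies into shells where `1 + |ζ|` is about `2^n`. On a shell the weight bounds the `L²`
norm of the piece by `2^{-n/2} ‖u‖` (`norm_cutoff_fourierL2_le`). Interpolating between Plancherel
and the sup bound from Cauchy–Schwarz costs a factor `(4^n)^{1/2 - 1/q}` in `L^q`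
(`norm_bandLp_le`). The product is geometric with ratio below 1 exactly because `q < 4`
(`summable_norm_dyadicPiece`).

Each piece is compact into `L^q(K)`: band-limited functions are uniformly Lipschitz, so
Arzelà–Ascoli applies (`isCompactOperator_bandLp`). The operator-norm sum of the pieces is therefore
compact, and comparing limits in measure identifies it with the inclusion. Tychonoff's theorem
passes from all `L^q(K)` to `L^q_loc`, which sits as a closed subspace of their product
(`isClosed_range_restrictAll`). -/

noncomputable section

namespace ShriraSpace

open Filter Topology
open scoped BoundedContinuousFunction

/-! ### Two criteria for compactness of an operator. -/

section CompactOperators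

/-- An operator dominated in norm by a compact operator is compact. -/
theorem isCompactOperator_of_norm_le {𝕂 E F G : Type*} [NontriviallyNormedField 𝕂]
    [SeminormedAddCommGroup E] [NormedSpace 𝕂 E] [NormedAddCommGroup F] [NormedSpace 𝕂 F]
    [NormedAddCommGroup G] [NormedSpace 𝕂 G] [CompleteSpace F] {T : E →L[𝕂] F} {R : E →L[𝕂] G}
    (hR : IsCompactOperator R) {C : ℝ} (h : ∀ f, ‖T f‖ ≤ C * ‖R f‖) : IsCompactOperator T := by
  have hR' : TotallyBounded (R '' Metric.closedBall 0 1) :=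
    ((IsCompactOperator.isCompact_closure_image_closedBall (f := (R : E →ₗ[𝕂] G)) hR
      1).totallyBounded).subset subset_closure
  have hT : TotallyBounded (T '' Metric.closedBall 0 1) := by
    rw [Metric.totallyBounded_iff]
    intro ε hε
    have hC : 0 < |C| + 1 := by positivity
    -- The net is taken inside the image of the ball, so its centres have preimages `g y`, and the
    -- `T (g y)` form a net for `T`. Using `|C| + 1` keeps the divisor positive for every `C`.
    obtain ⟨t, hts, htf, ht⟩ :=
      Metric.finite_approx_of_totallyBounded hR' (ε / (|C| + 1)) (by positivity)
    have hts' : ∀ y ∈ t, ∃ f : E, f ∈ Metric.closedBall 0 1 ∧ R f = y := fun y hy => hts hy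
    choose! g _ hg2 using hts'
    refine ⟨(fun y => T (g y)) '' t, htf.image _, ?_⟩
    rintro _ ⟨f, hf, rfl⟩
    obtain ⟨y, hy, hfy⟩ := Set.mem_iUnion₂.1 (ht ⟨f, hf, rfl⟩)
    refine Set.mem_iUnion₂.2 ⟨_, ⟨y, hy, rfl⟩, ?_⟩
    rw [Metric.mem_ball, dist_eq_norm] at hfy ⊢
    rw [← map_sub]
    rw [← hg2 y hy, ← map_sub, lt_div_iff₀ hC] at hfy
    calc ‖T (f - g y)‖ ≤ C * ‖R (f - g y)‖ := h _
      _ ≤ ‖R (f - g y)‖ * (|C| + 1) := by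
        rw [mul_comm]
        gcongr
        linarith [le_abs_self C]
      _ < ε := hfy
  change IsCompactOperator (T : E →ₗ[𝕂] F)
  rw [isCompactOperator_iff_isCompact_closure_image_closedBall (T : E →ₗ[𝕂] F) zero_lt_one]
  exact hT.closure.isCompact_of_isClosed isClosed_closure

/-- An operator into bounded functions on a compact metric space, whose values are Lipschitz with a
constant controlled by the norm of the argument, is compact. -/
theorem isCompactOperator_of_lipschitz {𝕂 E X : Type*} [RCLike 𝕂] [SeminormedAddCommGroup E]
    [NormedSpace 𝕂 E] [PseudoMetricSpace X] [CompactSpace X] (T : E →L[𝕂] (X →ᵇ 𝕂)) {L : ℝ}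
    (h : ∀ f x y, ‖T f x - T f y‖ ≤ L * ‖f‖ * dist x y) : IsCompactOperator T := by
  change IsCompactOperator (T : E →ₗ[𝕂] (X →ᵇ 𝕂))
  rw [isCompactOperator_iff_isCompact_closure_image_closedBall (T : E →ₗ[𝕂] (X →ᵇ 𝕂)) zero_lt_one]
  refine BoundedContinuousFunction.arzela_ascoli (Metric.closedBall 0 ‖T‖)
    (isCompact_closedBall _ _) _ ?_ ?_
  · rintro _ x ⟨f, hf, rfl⟩
    rw [mem_closedBall_zero_iff] at hf ⊢
    calc ‖T f x‖ ≤ ‖T f‖ := (T f).norm_coe_le_norm x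
      _ ≤ ‖T‖ * ‖f‖ := T.le_opNorm f
      _ ≤ ‖T‖ := mul_le_of_le_one_right (norm_nonneg _) hf
  · refine Metric.equicontinuous_of_continuity_modulus (fun r => |L| * r) ?_ _ ?_
    · have : Continuous fun r : ℝ => |L| * r := by fun_prop
      simpa using this.tendsto 0
    · rintro x y ⟨_, f, hf, rfl⟩
      rw [mem_closedBall_zero_iff] at hf
      rw [dist_eq_norm]
      refine (h f x y).trans ?_
      gcongr
      calc L * ‖f‖ ≤ |L| * ‖f‖ := by gcongr; exact le_abs_self L
        _ ≤ |L| := mul_le_of_le_one_right (abs_nonneg _) hf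

end CompactOperators

/-! ### Interpolation between `L²` and `L^∞`. -/

section Interpolation

/-- Integrate `|f|^q ≤ M^(q-2) |f|²` and take `q`-th roots. -/
theorem eLpNorm_le_of_ae_bound_of_two_le {α F : Type*} [MeasurableSpace α] {μ : Measure α}
    [NormedAddCommGroup F] {f : α → F} {q : ℝ≥0∞} (hq : 2 ≤ q) (hq' : q ≠ ∞) {M : ℝ≥0∞}
    (hM' : M ≠ ∞)     (hM : ∀ᵐ x ∂μ, ‖f x‖ₑ ≤ M) :
    eLpNorm f q μ ≤ M ^ (1 - 2 / q.toReal) * eLpNorm f 2 μ ^ (2 / q.toReal) := by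
  have hr : (2 : ℝ) ≤ q.toReal := by
    simpa using (ENNReal.toReal_le_toReal (by simp) hq').2 hq
  have hr0 : 0 < q.toReal := by linarith
  have h0 : q ≠ 0 := (zero_lt_two.trans_le hq).ne'
  rw [eLpNorm_eq_lintegral_rpow_enorm_toReal h0 hq',
    eLpNorm_eq_lintegral_rpow_enorm_toReal two_ne_zero (by simp)]
  have h : ∫⁻ x, ‖f x‖ₑ ^ q.toReal ∂μ ≤
      M ^ (q.toReal - 2) * ∫⁻ x, ‖f x‖ₑ ^ (2 : ℝ) ∂μ := by
    rw [← lintegral_const_mul' _ _ (ENNReal.rpow_ne_top_of_nonneg (by linarith) hM')]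
    refine lintegral_mono_ae ?_
    filter_upwards [hM] with x hx
    calc ‖f x‖ₑ ^ q.toReal = ‖f x‖ₑ ^ (q.toReal - 2) * ‖f x‖ₑ ^ (2 : ℝ) := by
          rw [← ENNReal.rpow_add_of_nonneg _ _ (by linarith) (by norm_num)]
          ring_nf
      _ ≤ _ := by gcongr
  calc (∫⁻ x, ‖f x‖ₑ ^ q.toReal ∂μ) ^ (1 / q.toReal)
      ≤ (M ^ (q.toReal - 2) * ∫⁻ x, ‖f x‖ₑ ^ (2 : ℝ) ∂μ) ^ (1 / q.toReal) := by gcongr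
    _ = _ := by
      rw [ENNReal.mul_rpow_of_nonneg _ _ (by positivity), ← ENNReal.rpow_mul, ← ENNReal.rpow_mul]
      congr 2
      · field_simp
      · simp
        field_simp

end Interpolation

/-! ### The `L²` inverse transform against the Fourier integral. -/

section FourierInversion

variable {V : Type*} [NormedAddCommGroup V] [InnerProductSpace ℝ V] [FiniteDimensional ℝ V]
  [MeasurableSpace V] [BorelSpace V]

theorem continuous_fourierInv_of_integrable {g : V → ℂ} (hg : Integrable g) :
    Continuous (𝓕⁻ g : V → ℂ) := by
  rw [← Real.Lp.fourierTransformInv_toLp (memLp_one_iff_integrable.2 hg)]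
  exact BoundedContinuousFunction.continuous _

/-- Fubini, with the inverse transform seen as the Fourier integral of the symmetric form `-⟨x, y⟩`.
-/
theorem integral_fourierInv_smul_eq {f g : V → ℂ} (hf : Integrable f) (hg : Integrable g) :
    ∫ x, (𝓕⁻ f : V → ℂ) x • g x = ∫ x, f x • (𝓕⁻ g : V → ℂ) x := by
  have h := VectorFourier.integral_fourierIntegral_smul_eq_flip (L := -innerₗ V)
    Real.continuous_fourierChar (by simpa using! continuous_inner.neg) hf hg
  have hflip : (-innerₗ V).flip = -innerₗ V := by
    ext x y
    simp [real_inner_comm]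
  rw [hflip] at h
  exact h

/-- On `L¹ ∩ L²` the inverse Fourier transform of `L²` is given by the Fourier integral. -/
theorem fourierInv_toLp_ae_eq {g : V → ℂ} (h1 : Integrable g) (h2 : MemLp g 2) :
    (𝓕⁻ (h2.toLp g : Lp ℂ 2 (volume : Measure V)) : Lp ℂ 2 (volume : Measure V))
      =ᵐ[volume] (𝓕⁻ g : V → ℂ) := by
  -- It suffices to test against smooth compactly supported `φ`. The `L²` transform agrees with the
  -- distributional one, which moves onto `φ` by duality; the Fourier integral moves onto `φ` by
  -- Fubini.
  refine ae_eq_of_integral_contDiff_smul_eq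
    ((Lp.memLp _).locallyIntegrable (by norm_num))
    (continuous_fourierInv_of_integrable h1).locallyIntegrable fun φ hφ hφc => ?_
  have hc : HasCompactSupport (Complex.ofRealCLM ∘ φ) := hφc.comp_left rfl
  have hs : ContDiff ℝ (⊤ : ℕ∞) (Complex.ofRealCLM ∘ φ) := by fun_prop
  have key := congrArg (fun T => T (hc.toSchwartzMap hs))
    (Lp.fourierInv_toTemperedDistribution_eq (h2.toLp g : Lp ℂ 2 (volume : Measure V)))
  simp only [TemperedDistribution.fourierInv_apply, Lp.toTemperedDistribution_apply] at key
  have e1 : ∫ x, (𝓕⁻ (hc.toSchwartzMap hs)) x • (h2.toLp g : Lp ℂ 2 (volume : Measure V)) x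
      = ∫ x, (𝓕⁻ (hc.toSchwartzMap hs)) x • g x := by
    refine integral_congr_ae ?_
    filter_upwards [h2.coeFn_toLp] with x hx
    rw [hx]
  rw [e1, SchwartzMap.fourierInv_coe,
    integral_fourierInv_smul_eq (hc.toSchwartzMap hs).integrable h1] at key
  exact key.symm

end FourierInversion

/-! ### Frequency cutoffs and band-limited functions. -/

section Cutoff

variable {V : Type*} [NormedAddCommGroup V] [InnerProductSpace ℝ V] [FiniteDimensional ℝ V]
  [MeasurableSpace V] [BorelSpace V]

/-- Multiplication by the indicator function of a measurable set, on `L²`. -/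
def cutoff {D : Set V} (hD : MeasurableSet D) :
    Lp ℂ 2 (volume : Measure V) →L[ℂ] Lp ℂ 2 (volume : Measure V) :=
  LinearMap.mkContinuous
    { toFun := fun f => ((Lp.memLp f).indicator hD).toLp _
      map_add' := fun f g => by
        refine (MemLp.toLp_eq_toLp_iff _ (((Lp.memLp f).indicator hD).add
          ((Lp.memLp g).indicator hD))).2 ?_
        filter_upwards [Lp.coeFn_add f g] with x hx
        simp only [Set.indicator, Pi.add_apply, hx]
        split_ifs <;> simp
      map_smul' := fun a f => by
        refine (MemLp.toLp_eq_toLp_iff _ (((Lp.memLp f).indicator hD).const_smul a)).2 ?_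
        filter_upwards [Lp.coeFn_smul a f] with x hx
        simp only [Set.indicator, Pi.smul_apply, hx]
        split_ifs <;> simp }
    1 fun f => by
      change ‖((Lp.memLp f).indicator hD).toLp _‖ ≤ _
      rw [one_mul]
      refine Lp.norm_le_norm_of_ae_le ?_
      filter_upwards [((Lp.memLp f).indicator hD).coeFn_toLp] with x hx
      rw [hx]
      exact norm_indicator_le_norm_self _ _

theorem cutoff_apply {D : Set V} (hD : MeasurableSet D) (f : Lp ℂ 2 (volume : Measure V)) :
    cutoff hD f = ((Lp.memLp f).indicator hD).toLp _ := rfl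

theorem coeFn_cutoff {D : Set V} (hD : MeasurableSet D) (f : Lp ℂ 2 (volume : Measure V)) :
    cutoff hD f =ᵐ[volume] D.indicator f :=
  ((Lp.memLp f).indicator hD).coeFn_toLp

/-- Cauchy–Schwarz on `D`. The bound keeps `‖cutoff hD f‖` instead of `‖f‖`, since the decay over
the shells lives in the former. -/
theorem eLpNorm_one_indicator_le {D : Set V} (hD : MeasurableSet D)
    (f : Lp ℂ 2 (volume : Measure V)) :
    eLpNorm (D.indicator f) 1 volume ≤
      ENNReal.ofReal ‖cutoff hD f‖ * volume D ^ (1 / 2 : ℝ) := by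
  rw [eLpNorm_indicator_eq_eLpNorm_restrict hD, ofReal_norm, Lp.enorm_def,
    eLpNorm_congr_ae (coeFn_cutoff hD f), eLpNorm_indicator_eq_eLpNorm_restrict hD]
  refine (eLpNorm_le_eLpNorm_mul_rpow_measure_univ one_le_two
    (Lp.aestronglyMeasurable f).restrict).trans_eq ?_
  rw [Measure.restrict_apply_univ]
  norm_num

theorem memLp_one_indicator {D : Set V} (hD : MeasurableSet D) (hD' : volume D ≠ ∞)
    (f : Lp ℂ 2 (volume : Measure V)) : MemLp (D.indicator f) 1 volume := by
  refine ⟨(Lp.aestronglyMeasurable f).indicator hD, ?_⟩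
  refine (eLpNorm_one_indicator_le hD f).trans_lt ?_
  exact ENNReal.mul_lt_top ENNReal.ofReal_lt_top (ENNReal.rpow_lt_top_of_nonneg (by norm_num) hD')

/-- Restriction of `L²` functions to a set of finite measure, with values in `L¹`. -/
def cutoffL1 {D : Set V} (hD : MeasurableSet D) (hD' : volume D ≠ ∞) :
    Lp ℂ 2 (volume : Measure V) →L[ℂ] Lp ℂ 1 (volume : Measure V) :=
  LinearMap.mkContinuous
    { toFun := fun f => (memLp_one_indicator hD hD' f).toLp _
      map_add' := fun f g => by
        refine (MemLp.toLp_eq_toLp_iff _ ((memLp_one_indicator hD hD' f).add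
          (memLp_one_indicator hD hD' g))).2 ?_
        filter_upwards [Lp.coeFn_add f g] with x hx
        simp only [Set.indicator, Pi.add_apply, hx]
        split_ifs <;> simp
      map_smul' := fun a f => by
        refine (MemLp.toLp_eq_toLp_iff _ ((memLp_one_indicator hD hD' f).const_smul a)).2 ?_
        filter_upwards [Lp.coeFn_smul a f] with x hx
        simp only [Set.indicator, Pi.smul_apply, hx]
        split_ifs <;> simp }
    ((volume D ^ (1 / 2 : ℝ)).toReal * ‖cutoff hD‖) fun f => by
      change ‖(memLp_one_indicator hD hD' f).toLp _‖ ≤ _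
      rw [Lp.norm_toLp]
      refine (ENNReal.toReal_mono ?_ (eLpNorm_one_indicator_le hD f)).trans ?_
      · exact ENNReal.mul_ne_top ENNReal.ofReal_ne_top
          (ENNReal.rpow_ne_top_of_nonneg (by norm_num) hD')
      rw [ENNReal.toReal_mul, ENNReal.toReal_ofReal (norm_nonneg _), mul_comm, mul_assoc]
      gcongr
      exact (cutoff hD).le_opNorm f

/-- The part of `𝓕⁻ f` with frequencies in a set of finite measure, a bounded continuous
function. -/
def band {D : Set V} (hD : MeasurableSet D) (hD' : volume D ≠ ∞) :
    Lp ℂ 2 (volume : Measure V) →L[ℂ] (V →ᵇ ℂ) :=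
  Real.Lp.fourierTransformInvCLM V ℂ ∘L cutoffL1 hD hD'

theorem coe_band {D : Set V} (hD : MeasurableSet D) (hD' : volume D ≠ ∞)
    (f : Lp ℂ 2 (volume : Measure V)) : ⇑(band hD hD' f) = 𝓕⁻ (D.indicator f) := by
  rw [band, ContinuousLinearMap.comp_apply, Real.Lp.fourierTransformInvCLM_apply]
  exact Real.Lp.fourierTransformInv_toLp (memLp_one_indicator hD hD' f)

theorem band_ae_eq {D : Set V} (hD : MeasurableSet D) (hD' : volume D ≠ ∞)
    (f : Lp ℂ 2 (volume : Measure V)) :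
    (𝓕⁻ (cutoff hD f) : Lp ℂ 2 (volume : Measure V)) =ᵐ[volume] band hD hD' f := by
  rw [coe_band, cutoff_apply]
  exact fourierInv_toLp_ae_eq (memLp_one_iff_integrable.1 (memLp_one_indicator hD hD' f)) _

theorem enorm_band_apply_le {D : Set V} (hD : MeasurableSet D) (hD' : volume D ≠ ∞)
    (f : Lp ℂ 2 (volume : Measure V)) (x : V) :
    ‖band hD hD' f x‖ₑ ≤ ENNReal.ofReal ‖cutoff hD f‖ * volume D ^ (1 / 2 : ℝ) := by
  refine le_trans ?_ (eLpNorm_one_indicator_le hD f)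
  rw [coe_band, eLpNorm_one_eq_lintegral_enorm, Real.fourierInv_eq]
  refine (enorm_integral_le_lintegral_enorm _).trans_eq ?_
  refine lintegral_congr fun v => ?_
  rw [← ofReal_norm, ← ofReal_norm, Circle.norm_smul]

theorem norm_fourierChar_sub_le (a b : ℝ) :
    ‖((Real.fourierChar a : Circle) : ℂ) - Real.fourierChar b‖ ≤ 2 * Real.pi * |a - b| := by
  have h : ((Real.fourierChar a : Circle) : ℂ) - Real.fourierChar b =
      Real.fourierChar b * (Complex.exp (Complex.I * ((2 * Real.pi * (a - b) : ℝ) : ℂ)) - 1) := by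
    rw [Real.fourierChar_apply, Real.fourierChar_apply, mul_sub, ← Complex.exp_add, mul_one]
    congr 2
    push_cast
    ring
  rw [h, norm_mul, Circle.norm_coe, one_mul]
  refine (Real.norm_exp_I_mul_ofReal_sub_one_le).trans_eq ?_
  rw [Real.norm_eq_abs, abs_mul, abs_of_pos Real.two_pi_pos]

/-- For `‖v‖ ≤ r` the character `x ↦ 𝐞 ⟨v, x⟩` is `2πr`-Lipschitz. This is the equicontinuity needed
for Arzelà–Ascoli. -/
theorem norm_band_sub_le {D : Set V} (hD : MeasurableSet D) (hD' : volume D ≠ ∞) {r : ℝ}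
    (hr0 : 0 ≤ r) (hr : ∀ v ∈ D, ‖v‖ ≤ r) (f : Lp ℂ 2 (volume : Measure V)) (x y : V) :
    ‖band hD hD' f x - band hD hD' f y‖ ≤
      2 * Real.pi * r * ‖cutoffL1 hD hD'‖ * ‖f‖ * dist x y := by
  have hi := memLp_one_iff_integrable.1 (memLp_one_indicator hD hD' f)
  have hconv : ∀ z : V, Integrable (fun v => 𝐞 (inner ℝ v z) • D.indicator f v) := fun z => by
    have := (Real.fourierIntegral_convergent_iff (-z)).2 hi
    simpa using this
  have hn : ∫ v, ‖D.indicator f v‖ = ‖cutoffL1 hD hD' f‖ := by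
    rw [L1.norm_eq_integral_norm]
    refine integral_congr_ae ?_
    filter_upwards [(memLp_one_indicator hD hD' f).coeFn_toLp] with v hv
    rw [← hv]
    rfl
  rw [coe_band, Real.fourierInv_eq, Real.fourierInv_eq, ← integral_sub (hconv x) (hconv y)]
  have hle : ∀ v, ‖𝐞 (inner ℝ v x) • D.indicator f v - 𝐞 (inner ℝ v y) • D.indicator f v‖ ≤
      2 * Real.pi * r * dist x y * ‖D.indicator f v‖ := fun v => by
    by_cases hv : v ∈ D
    · rw [Circle.smul_def, Circle.smul_def, ← sub_smul, norm_smul]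
      gcongr
      refine (norm_fourierChar_sub_le _ _).trans ?_
      rw [← inner_sub_right, mul_assoc (2 * Real.pi), dist_eq_norm]
      gcongr
      refine (abs_real_inner_le_norm _ _).trans ?_
      gcongr
      exact hr v hv
    · simp [hv]
  refine (norm_integral_le_of_norm_le (hi.norm.const_mul _) (Eventually.of_forall hle)).trans ?_
  rw [integral_const_mul, hn]
  calc 2 * Real.pi * r * dist x y * ‖cutoffL1 hD hD' f‖
        ≤ 2 * Real.pi * r * dist x y * (‖cutoffL1 hD hD'‖ * ‖f‖) := by
          gcongr
          exact (cutoffL1 hD hD').le_opNorm f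
      _ = _ := by ring

end Cutoff

/-! ### Band-limited functions in `L^q` of a finite measure. -/

section BandLp

variable {V : Type*} [NormedAddCommGroup V] [InnerProductSpace ℝ V] [FiniteDimensional ℝ V]
  [MeasurableSpace V] [BorelSpace V]

/-- The part of `𝓕⁻ f` with frequencies in a set of finite measure, as an element of `L^q` for a
finite measure. -/
def bandLp (q : ℝ≥0∞) [Fact (1 ≤ q)] (μ : Measure V) [IsFiniteMeasure μ] {D : Set V}
    (hD : MeasurableSet D) (hD' : volume D ≠ ∞) :
    Lp ℂ 2 (volume : Measure V) →L[ℂ] Lp ℂ q μ :=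
  BoundedContinuousFunction.toLp q μ ℂ ∘L band hD hD'

theorem bandLp_ae_eq {q : ℝ≥0∞} [Fact (1 ≤ q)] {μ : Measure V} [IsFiniteMeasure μ] {D : Set V}
    (hD : MeasurableSet D) (hD' : volume D ≠ ∞) (f : Lp ℂ 2 (volume : Measure V)) :
    bandLp q μ hD hD' f =ᵐ[μ] band hD hD' f :=
  BoundedContinuousFunction.coeFn_toLp _ μ ℂ _

/-- Interpolates the sup bound `|D|^{1/2} ‖cutoff hD f‖` with the `L²` bound `‖cutoff hD f‖`; the
exponent is `(1/2)(1 - 2/q) = 1/2 - 1/q`. -/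
theorem norm_bandLp_le {q : ℝ≥0∞} [Fact (1 ≤ q)] (hq : 2 ≤ q) (hq' : q ≠ ∞) {μ : Measure V}
    [IsFiniteMeasure μ] (hμ : μ ≤ volume) {D : Set V} (hD : MeasurableSet D)
    (hD' : volume D ≠ ∞) (f : Lp ℂ 2 (volume : Measure V)) :
    ‖bandLp q μ hD hD' f‖ ≤
      (volume D).toReal ^ (1 / 2 - 1 / q.toReal : ℝ) * ‖cutoff hD f‖ := by
  have hr : (2 : ℝ) ≤ q.toReal := by
    simpa using (ENNReal.toReal_le_toReal (by simp) hq').2 hq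
  have hr1 : 2 / q.toReal ≤ 1 := (div_le_one (by linarith)).2 hr
  have hr0 : 0 < 2 / q.toReal := by positivity
  set M : ℝ≥0∞ := ENNReal.ofReal ‖cutoff hD f‖ * volume D ^ (1 / 2 : ℝ) with hM
  have hM' : M ≠ ∞ := ENNReal.mul_ne_top ENNReal.ofReal_ne_top
    (ENNReal.rpow_ne_top_of_nonneg (by norm_num) hD')
  -- Plancherel, after enlarging `μ` to Lebesgue measure.
  have h2 : eLpNorm (band hD hD' f) 2 μ ≤ ENNReal.ofReal ‖cutoff hD f‖ := by
    refine (eLpNorm_mono_measure _ hμ).trans_eq ?_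
    rw [← eLpNorm_congr_ae (band_ae_eq hD hD' f), ← Lp.enorm_def, ← ofReal_norm]
    congr 1
    exact (Lp.fourierTransformₗᵢ V ℂ).symm.norm_map _
  have h3 := eLpNorm_le_of_ae_bound_of_two_le (μ := μ) hq hq' hM'
    (Eventually.of_forall (enorm_band_apply_le hD hD' f))
  have h4 : eLpNorm (bandLp q μ hD hD' f) q μ ≤
      M ^ (1 - 2 / q.toReal) * ENNReal.ofReal ‖cutoff hD f‖ ^ (2 / q.toReal) := by
    rw [eLpNorm_congr_ae (bandLp_ae_eq hD hD' f)]
    refine h3.trans ?_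
    gcongr
  rw [Lp.norm_def]
  refine (ENNReal.toReal_mono ?_ h4).trans_eq ?_
  · exact ENNReal.mul_ne_top (ENNReal.rpow_ne_top_of_nonneg (by linarith) hM')
      (ENNReal.rpow_ne_top_of_nonneg hr0.le ENNReal.ofReal_ne_top)
  · rw [hM, ENNReal.toReal_mul, ← ENNReal.toReal_rpow, ← ENNReal.toReal_rpow, ENNReal.toReal_mul,
      ENNReal.toReal_ofReal (norm_nonneg _), ← ENNReal.toReal_rpow,
      Real.mul_rpow (norm_nonneg _) (by positivity), ← Real.rpow_mul (by positivity),
      mul_right_comm, ← Real.rpow_add_of_nonneg (norm_nonneg _) (by linarith) hr0.le]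
    rw [sub_add_cancel, Real.rpow_one, mul_comm]
    congr 2
    ring

/-- Restriction to `K` is compact in the sup norm by the Lipschitz bound, and since `μ` is finite
and carried by `K`, that norm dominates the `L^q(μ)` norm. -/
theorem isCompactOperator_bandLp {q : ℝ≥0∞} [Fact (1 ≤ q)] {μ : Measure V} [IsFiniteMeasure μ]
    {K : Set V} (hK : IsCompact K) (hμK : ∀ᵐ x ∂μ, x ∈ K) {D : Set V} (hD : MeasurableSet D)
    (hD' : volume D ≠ ∞) {r : ℝ} (hr0 : 0 ≤ r) (hr : ∀ v ∈ D, ‖v‖ ≤ r) :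
    IsCompactOperator (bandLp q μ hD hD') := by
  have := isCompact_iff_compactSpace.1 hK
  set ρ : (V →ᵇ ℂ) →L[ℂ] (K →ᵇ ℂ) :=
    BoundedContinuousFunction.compContinuousCLM ℂ ℂ ⟨Subtype.val, continuous_subtype_val⟩
  have hR : IsCompactOperator (ρ ∘L band hD hD') :=
    isCompactOperator_of_lipschitz _ fun f x y => norm_band_sub_le hD hD' hr0 hr f x y
  refine isCompactOperator_of_norm_le hR
    (C := (measureUnivNNReal μ : ℝ) ^ q.toReal⁻¹) fun f => ?_
  refine Lp.norm_le_of_ae_bound (norm_nonneg _) ?_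
  filter_upwards [bandLp_ae_eq (q := q) hD hD' f, hμK] with x hx hxK
  rw [hx]
  exact (ρ (band hD hD' f)).norm_coe_le_norm ⟨x, hxK⟩

end BandLp

/-! ### The energy norm on the Fourier side. -/

section Energy

variable {𝕜 : Type*} [RCLike 𝕜]

theorem norm_rclike_map {𝕜 : Type*} [RCLike 𝕜] (z : 𝕜) : ‖RCLike.map 𝕜 ℂ z‖ = ‖z‖ := by
  rw [← sq_eq_sq₀ (norm_nonneg _) (norm_nonneg _), ← RCLike.normSq_eq_def', RCLike.normSq_apply,
    ← RCLike.normSq_eq_def', RCLike.normSq_apply]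
  simp

theorem rclike_map_map {𝕜 : Type*} [RCLike 𝕜] (z : 𝕜) :
    RCLike.map ℂ 𝕜 (RCLike.map 𝕜 ℂ z) = z := by
  simp

theorem coeFn_toComplex (u : Lp 𝕜 2 (volume : Measure Plane)) :
    toComplex 𝕜 u =ᵐ[volume] fun x => RCLike.map 𝕜 ℂ (u x) :=
  (RCLike.map 𝕜 ℂ).coeFn_compLpL u

theorem norm_toComplex (u : Lp 𝕜 2 (volume : Measure Plane)) : ‖toComplex 𝕜 u‖ = ‖u‖ := by
  rw [Lp.norm_def, Lp.norm_def]
  congr 1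
  refine eLpNorm_congr_norm_ae ?_
  filter_upwards [coeFn_toComplex u] with x hx
  rw [hx, norm_rclike_map]

/-- Off the line `ξ = 0`, the symbols control the weight of the isotropic Sobolev space
`H^{1/2}`. -/
theorem one_add_norm_le_symb (ζ : Plane) (h : ζ 0 ≠ 0) :
    1 + ‖ζ‖ ≤ 1 + ‖symbDx ζ‖ ^ 2 + ‖symbDy ζ‖ ^ 2 := by
  have hpi : (3 : ℝ) < Real.pi := Real.pi_gt_three
  set a : ℝ := |2 * Real.pi * ζ 0| with ha
  set b : ℝ := |2 * Real.pi * ζ 1| with hb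
  have ha0 : 0 < a := abs_pos.2 (mul_ne_zero Real.two_pi_pos.ne' h)
  have h1 : ‖symbDx ζ‖ ^ 2 = a := by
    rw [symbDx, Complex.norm_real, Real.norm_of_nonneg (by positivity), ← Real.rpow_natCast,
      ← Real.rpow_mul (abs_nonneg _), ← ha, show (1 / 2 : ℝ) * ((2 : ℕ) : ℝ) = 1 by norm_num,
      Real.rpow_one]
  have h2 : ‖symbDy ζ‖ ^ 2 = a⁻¹ * b ^ 2 := by
    rw [symbDy, norm_mul, norm_mul, Complex.norm_real, Complex.norm_real, Complex.norm_I, one_mul,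
      mul_pow, Real.norm_of_nonneg (by positivity), ← Real.rpow_natCast,
      ← Real.rpow_mul (abs_nonneg _), Real.norm_eq_abs, ← hb, ← ha,
      show (-(1 / 2) : ℝ) * ((2 : ℕ) : ℝ) = -1 by norm_num, Real.rpow_neg_one]
  have h3 : ‖ζ‖ ≤ |ζ 0| + |ζ 1| := by
    rw [EuclideanSpace.norm_eq, Real.sqrt_le_left (by positivity)]
    simp only [Fin.sum_univ_two, Real.norm_eq_abs]
    nlinarith [mul_nonneg (abs_nonneg (ζ 0)) (abs_nonneg (ζ 1))]
  have h4 : ∀ t : ℝ, 2 * |t| ≤ |2 * Real.pi * t| := fun t => by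
    rw [abs_mul, abs_of_pos Real.two_pi_pos]
    gcongr
    linarith
  -- AM-GM: the two anisotropic terms together recover the missing control of `|η|`.
  have h5 : 2 * b ≤ a + a⁻¹ * b ^ 2 := by
    have : a + a⁻¹ * b ^ 2 - 2 * b = a⁻¹ * (a - b) ^ 2 := by
      field_simp
      ring
    have : 0 ≤ a⁻¹ * (a - b) ^ 2 := by positivity
    linarith
  have h6 : 0 ≤ a⁻¹ * b ^ 2 := by positivity
  rw [h1, h2]
  linarith [h4 (ζ 0), h4 (ζ 1)]

/-- A proper subspace is null. On this line both symbols vanish by the convention for real powers of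
`0`, so the lower bound on the weight fails there. -/
theorem ae_apply_zero_ne_zero : ∀ᵐ ζ : Plane, ζ 0 ≠ 0 := by
  have h : (LinearMap.ker (EuclideanSpace.proj (𝕜 := ℝ) (0 : Fin 2)).toLinearMap) ≠ ⊤ := by
    rw [Ne, LinearMap.ker_eq_top]
    intro h
    have := LinearMap.congr_fun h (EuclideanSpace.single (0 : Fin 2) (1 : ℝ))
    simp at this
  have := Measure.addHaar_submodule (volume : Measure Plane) _ h
  rw [ae_iff]
  convert this using 2
  ext ζ
  simp

namespace EnergySpace

variable {c : ℝ} {hc : 0 < c}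

theorem norm_toL2_sq_le (u : EnergySpace 𝕜 c hc) : ‖u.toL2‖ ^ 2 ≤ c⁻¹ * ‖u‖ ^ 2 := by
  rw [norm_sq_eq_add, ← mul_le_mul_iff_right₀ hc, mul_inv_cancel_left₀ hc.ne']
  linarith [sq_nonneg ‖halfDx 𝕜 (toSubmodule u)‖, sq_nonneg ‖negHalfDxDy 𝕜 (toSubmodule u)‖]

/-- The Fourier transform on the energy space. -/
def fourierL2 : EnergySpace 𝕜 c hc →L[ℝ] Lp ℂ 2 (volume : Measure Plane) :=
  LinearMap.mkContinuous
    (((Lp.fourierTransformₗᵢ Plane ℂ).toLinearEquiv.toLinearMap.restrictScalars ℝ) ∘ₗ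
      (toComplex 𝕜).toLinearMap ∘ₗ (energySubmodule 𝕜).subtype ∘ₗ toSubmodule.toLinearMap)
    (Real.sqrt c⁻¹) fun u => by
      change ‖(Lp.fourierTransformₗᵢ Plane ℂ) (toComplex 𝕜 u.toL2)‖ ≤ _
      rw [LinearIsometryEquiv.norm_map, norm_toComplex]
      refine Real.le_sqrt_of_sq_le (norm_toL2_sq_le u) |>.trans_eq ?_
      rw [Real.sqrt_mul (by positivity), Real.sqrt_sq (norm_nonneg _)]

theorem fourierL2_apply (u : EnergySpace 𝕜 c hc) :
    fourierL2 u = 𝓕 (toComplex 𝕜 u.toL2) := rfl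

theorem fourierInv_fourierL2 (u : EnergySpace 𝕜 c hc) :
    (𝓕⁻ (fourierL2 u) : Lp ℂ 2 (volume : Measure Plane)) = toComplex 𝕜 u.toL2 := by
  rw [fourierL2_apply]
  exact FourierTransform.fourierInv_fourier_eq _

theorem norm_halfDx_sq (u : EnergySpace 𝕜 c hc) :
    Integrable (fun ζ => ‖symbDx ζ * fourierL2 u ζ‖ ^ 2) ∧
      ‖halfDx 𝕜 (toSubmodule u)‖ ^ 2 = ∫ ζ, ‖symbDx ζ * fourierL2 u ζ‖ ^ 2 := by
  have hm : MemLp (fun ζ => symbDx ζ * fourierL2 u ζ) 2 volume := (toSubmodule u).2.1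
  refine ⟨hm.integrable_norm_pow (by norm_num), ?_⟩
  have : ‖halfDx 𝕜 (toSubmodule u)‖ = ‖hm.toLp _‖ :=
    (Lp.fourierTransformₗᵢ Plane ℂ).symm.norm_map _
  rw [this, L2_norm_sq]
  refine integral_congr_ae ?_
  filter_upwards [hm.coeFn_toLp] with ζ hζ
  rw [hζ]

theorem norm_negHalfDxDy_sq (u : EnergySpace 𝕜 c hc) :
    Integrable (fun ζ => ‖symbDy ζ * fourierL2 u ζ‖ ^ 2) ∧
      ‖negHalfDxDy 𝕜 (toSubmodule u)‖ ^ 2 = ∫ ζ, ‖symbDy ζ * fourierL2 u ζ‖ ^ 2 := by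
  have hm : MemLp (fun ζ => symbDy ζ * fourierL2 u ζ) 2 volume := (toSubmodule u).2.2
  refine ⟨hm.integrable_norm_pow (by norm_num), ?_⟩
  have : ‖negHalfDxDy 𝕜 (toSubmodule u)‖ = ‖hm.toLp _‖ :=
    (Lp.fourierTransformₗᵢ Plane ℂ).symm.norm_map _
  rw [this, L2_norm_sq]
  refine integral_congr_ae ?_
  filter_upwards [hm.coeFn_toLp] with ζ hζ
  rw [hζ]

/-- Turns the energy norm into frequency decay: it serves with `a = 2^n`, on shells for summability
and on complements of `lowFreq n` for convergence. -/
theorem norm_cutoff_fourierL2_le {D : Set Plane} (hD : MeasurableSet D) {a : ℝ}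
    (ha : ∀ ζ ∈ D, a ≤ 1 + ‖ζ‖) (u : EnergySpace 𝕜 c hc) :
    a * ‖cutoff hD (fourierL2 u)‖ ^ 2 ≤ (1 + c⁻¹) * ‖u‖ ^ 2 := by
  obtain ⟨i1, e1⟩ := norm_halfDx_sq u
  obtain ⟨i2, e2⟩ := norm_negHalfDxDy_sq u
  have i0 := L2_sq_integrable (fourierL2 u)
  have e0 : ‖u.toL2‖ ^ 2 = ∫ ζ, ‖fourierL2 u ζ‖ ^ 2 := by
    rw [← L2_norm_sq, fourierL2_apply, Lp.norm_fourier_eq, norm_toComplex]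
  have i01 : Integrable (fun ζ => ‖fourierL2 u ζ‖ ^ 2 + ‖symbDx ζ * fourierL2 u ζ‖ ^ 2) :=
    i0.add i1
  have key : a * ‖cutoff hD (fourierL2 u)‖ ^ 2 ≤
      ‖u.toL2‖ ^ 2 + ‖halfDx 𝕜 (toSubmodule u)‖ ^ 2 + ‖negHalfDxDy 𝕜 (toSubmodule u)‖ ^ 2 := by
    rw [e0, e1, e2, L2_norm_sq, ← integral_add i0 i1, ← integral_add i01 i2,
      ← integral_const_mul]
    refine integral_mono_ae ((L2_sq_integrable _).const_mul a) (i01.add i2) ?_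
    filter_upwards [coeFn_cutoff hD (fourierL2 u), ae_apply_zero_ne_zero] with ζ hζ hζ0
    beta_reduce
    rw [hζ]
    by_cases h : ζ ∈ D
    · rw [Set.indicator_of_mem h]
      calc a * ‖fourierL2 u ζ‖ ^ 2
          ≤ (1 + ‖symbDx ζ‖ ^ 2 + ‖symbDy ζ‖ ^ 2) * ‖fourierL2 u ζ‖ ^ 2 := by
            gcongr
            exact (ha ζ h).trans (one_add_norm_le_symb ζ hζ0)
        _ = _ := by
            rw [norm_mul, norm_mul]
            ring
    · rw [Set.indicator_of_notMem h, norm_zero]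
      calc a * 0 ^ 2 = 0 := by ring
        _ ≤ _ := by positivity
  -- The `L²` term is at most `c⁻¹ ‖u‖²` and the other two together at most `‖u‖²`, whence `1 +
  -- c⁻¹`.
  have h1 := norm_toL2_sq_le u
  have h2 := norm_sq_eq_add u
  have h3 : 0 ≤ c * ‖u.toL2‖ ^ 2 := by positivity
  linarith

end EnergySpace

end Energy

theorem tendstoInMeasure_mono_measure {α ι F : Type*} [MeasurableSpace α] [EDist F]
    {μ ν : Measure α} (h : μ ≤ ν) {f : ι → α → F} {g : α → F} {l : Filter ι}
    (hf : TendstoInMeasure ν f l g) : TendstoInMeasure μ f l g := fun ε hε =>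
  tendsto_of_tendsto_of_tendsto_of_le_of_le tendsto_const_nhds (hf ε hε) (fun _ => zero_le)
    fun _ => h _

/-! ### Dyadic shells of frequencies. -/

section Dyadic

theorem band_union {V : Type*} [NormedAddCommGroup V] [InnerProductSpace ℝ V]
    [FiniteDimensional ℝ V] [MeasurableSpace V] [BorelSpace V] {D₁ D₂ D : Set V}
    (h₁ : MeasurableSet D₁) (h₁' : volume D₁ ≠ ∞) (h₂ : MeasurableSet D₂) (h₂' : volume D₂ ≠ ∞)
    (h : MeasurableSet D) (h' : volume D ≠ ∞) (hD : D = D₁ ∪ D₂) (hdisj : Disjoint D₁ D₂)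
    (f : Lp ℂ 2 (volume : Measure V)) :
    band h h' f = band h₁ h₁' f + band h₂ h₂' f := by
  rw [band, band, band, ContinuousLinearMap.comp_apply, ContinuousLinearMap.comp_apply,
    ContinuousLinearMap.comp_apply, ← map_add]
  congr 1
  refine (MemLp.toLp_eq_toLp_iff (memLp_one_indicator h h' f) ((memLp_one_indicator h₁ h₁' f).add
    (memLp_one_indicator h₂ h₂' f))).2 (Eventually.of_forall fun x => ?_)
  rw [hD, Set.indicator_union_of_disjoint hdisj]
  rfl

/-- Frequencies with `1 + |ζ| < 2^n`. -/
def lowFreq (n : ℕ) : Set Plane := {ζ | 1 + ‖ζ‖ < 2 ^ n}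

/-- Frequencies with `2^n ≤ 1 + |ζ| < 2^(n+1)`. -/
def dyadicShell (n : ℕ) : Set Plane := lowFreq (n + 1) \ lowFreq n

theorem measurableSet_lowFreq (n : ℕ) : MeasurableSet (lowFreq n) :=
  measurableSet_lt (by fun_prop) (by fun_prop)

theorem measurableSet_dyadicShell (n : ℕ) : MeasurableSet (dyadicShell n) :=
  (measurableSet_lowFreq _).diff (measurableSet_lowFreq _)

theorem lowFreq_subset_ball (n : ℕ) : lowFreq n ⊆ Metric.ball 0 (2 ^ n) := fun ζ hζ => by
  rw [mem_ball_zero_iff]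
  have : 1 + ‖ζ‖ < 2 ^ n := hζ
  linarith

theorem dyadicShell_subset_ball (n : ℕ) : dyadicShell n ⊆ Metric.ball 0 (2 ^ (n + 1)) :=
  Set.sdiff_subset.trans (lowFreq_subset_ball _)

theorem volume_lowFreq_ne_top (n : ℕ) : volume (lowFreq n) ≠ ∞ :=
  ((measure_mono (lowFreq_subset_ball n)).trans_lt measure_ball_lt_top).ne

theorem volume_dyadicShell_ne_top (n : ℕ) : volume (dyadicShell n) ≠ ∞ :=
  ((measure_mono (dyadicShell_subset_ball n)).trans_lt measure_ball_lt_top).ne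

theorem volume_dyadicShell_le (n : ℕ) : (volume (dyadicShell n)).toReal ≤
    4 * (volume (Metric.ball (0 : Plane) 1)).toReal * 4 ^ n := by
  have h := ENNReal.toReal_mono measure_ball_lt_top.ne
    (measure_mono (μ := volume) (dyadicShell_subset_ball n))
  refine h.trans_eq ?_
  rw [Measure.addHaar_ball _ _ (by positivity), ENNReal.toReal_mul,
    ENNReal.toReal_ofReal (by positivity), finrank_euclideanSpace_fin, ← pow_mul, mul_comm (n + 1),
    pow_mul, pow_succ]
  norm_num
  ring

theorem lowFreq_succ (n : ℕ) : lowFreq (n + 1) = lowFreq n ∪ dyadicShell n := by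
  refine (Set.union_sdiff_cancel fun ζ hζ => ?_).symm
  have h : 1 + ‖ζ‖ < 2 ^ n := hζ
  exact h.trans_le (pow_le_pow_right₀ (by norm_num) n.le_succ)

theorem le_of_mem_dyadicShell {n : ℕ} {ζ : Plane} (h : ζ ∈ dyadicShell n) : 2 ^ n ≤ 1 + ‖ζ‖ :=
  not_lt.1 h.2

end Dyadic

/-! ### Dyadic decomposition and compactness into `L^q(K)`. -/

namespace EnergySpace

variable {𝕜 : Type*} [RCLike 𝕜] {c : ℝ} {hc : 0 < c}

section

variable (q : ℝ≥0∞) [Fact (1 ≤ q)] (μ : Measure Plane) [IsFiniteMeasure μ]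

/-- The part of a function in the energy space with frequencies in a dyadic shell. -/
def dyadicPiece (n : ℕ) : EnergySpace 𝕜 c hc →L[ℝ] Lp ℂ q μ :=
  (bandLp q μ (measurableSet_dyadicShell n) (volume_dyadicShell_ne_top n)).restrictScalars ℝ ∘L
    fourierL2

variable {q μ}

theorem isCompactOperator_dyadicPiece {K : Set Plane} (hK : IsCompact K)
    (hμK : ∀ᵐ x ∂μ, x ∈ K) (n : ℕ) :
    IsCompactOperator (dyadicPiece (𝕜 := 𝕜) (hc := hc) q μ n) := by
  have h := isCompactOperator_bandLp (q := q) hK hμK (measurableSet_dyadicShell n)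
    (volume_dyadicShell_ne_top n) (r := 2 ^ (n + 1)) (by positivity)
    (fun ζ hζ => (mem_ball_zero_iff.1 (dyadicShell_subset_ball n hζ)).le)
  exact h.comp_clm (fourierL2 (𝕜 := 𝕜) (hc := hc))

theorem sum_dyadicPiece (n : ℕ) (u : EnergySpace 𝕜 c hc) :
    ∑ i ∈ Finset.range n, dyadicPiece q μ i u =
      bandLp q μ (measurableSet_lowFreq n) (volume_lowFreq_ne_top n) (fourierL2 u) := by
  induction n with
  | zero =>
    -- `1 + ‖ζ‖ < 1` is impossible, so the shells from `n = 0` on already cover all frequencies and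
    -- no separate low-frequency term is needed.
    have h0 : lowFreq 0 = ∅ := by
      ext ζ
      simp [lowFreq]
    have : band (measurableSet_lowFreq 0) (volume_lowFreq_ne_top 0) (fourierL2 u) = 0 := by
      ext x
      rw [coe_band, h0, Set.indicator_empty, Real.fourierInv_eq]
      simp
    rw [Finset.sum_range_zero, bandLp, ContinuousLinearMap.comp_apply, this, map_zero]
  | succ n ih =>
    rw [Finset.sum_range_succ, ih, bandLp, ContinuousLinearMap.comp_apply, bandLp,
      ContinuousLinearMap.comp_apply, band_union (measurableSet_lowFreq n)
        (volume_lowFreq_ne_top n) (measurableSet_dyadicShell n) (volume_dyadicShell_ne_top n) _ _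
        (lowFreq_succ n) Set.disjoint_sdiff_right, map_add]
    rfl

theorem summable_norm_dyadicPiece (hq : 2 ≤ q) (hq' : q < 4) (hμ : μ ≤ volume) :
    Summable fun n => ‖dyadicPiece (𝕜 := 𝕜) (hc := hc) q μ n‖ := by
  have hqt : q ≠ ∞ := (hq'.trans (by simp)).ne
  have hr : (2 : ℝ) ≤ q.toReal := by
    simpa using (ENNReal.toReal_le_toReal (by simp) hqt).2 hq
  have hr' : q.toReal < 4 := by
    simpa using (ENNReal.toReal_lt_toReal hqt (by simp)).2 hq'
  set s : ℝ := 1 / 2 - 1 / q.toReal with hs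
  have hs0 : 0 ≤ s := by
    rw [hs, sub_nonneg]
    gcongr
  have hs1 : s < 1 / 4 := by
    have : 1 / 4 < 1 / q.toReal := by gcongr
    linarith
  set B : ℝ := 4 * (volume (Metric.ball (0 : Plane) 1)).toReal with hB
  have hB0 : 0 ≤ B := by positivity
  -- Shell volume contributes `4^s` per step and the energy decay `1/√2`; the ratio is below 1
  -- because `s < 1/4`, that is, `q < 4`.
  set ρ : ℝ := 4 ^ s / Real.sqrt 2 with hρ
  have hρ1 : ρ < 1 := by
    rw [hρ, div_lt_one (by positivity), Real.sqrt_eq_rpow]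
    calc (4 : ℝ) ^ s < 4 ^ (1 / 4 : ℝ) := Real.rpow_lt_rpow_of_exponent_lt (by norm_num) hs1
      _ = 2 ^ (1 / 2 : ℝ) := by
        rw [show (4 : ℝ) = 2 ^ (2 : ℝ) by norm_num, ← Real.rpow_mul (by norm_num)]
        norm_num
  refine Summable.of_nonneg_of_le (fun n => norm_nonneg _) (fun n => ?_)
    ((summable_geometric_of_lt_one (by positivity) hρ1).mul_left
      (B ^ s * Real.sqrt (1 + c⁻¹)))
  refine ContinuousLinearMap.opNorm_le_bound _ (by positivity) fun u => ?_
  have h1 := norm_bandLp_le hq hqt hμ (measurableSet_dyadicShell n) (volume_dyadicShell_ne_top n)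
    (fourierL2 u)
  have h2 : ‖cutoff (measurableSet_dyadicShell n) (fourierL2 u)‖ ≤
      Real.sqrt (1 + c⁻¹) * (1 / Real.sqrt 2) ^ n * ‖u‖ := by
    have h := norm_cutoff_fourierL2_le (measurableSet_dyadicShell n)
      (fun ζ hζ => le_of_mem_dyadicShell hζ) u
    refine le_of_sq_le_sq ?_ (by positivity)
    rw [mul_pow, mul_pow, Real.sq_sqrt (by positivity), ← pow_mul, mul_comm n, pow_mul, div_pow,
      Real.sq_sqrt (by norm_num), one_pow, one_div, inv_pow]
    rw [mul_right_comm, ← div_eq_mul_inv, le_div_iff₀ (by positivity), mul_comm]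
    exact h
  calc ‖dyadicPiece q μ n u‖
      ≤ (volume (dyadicShell n)).toReal ^ s *
        ‖cutoff (measurableSet_dyadicShell n) (fourierL2 u)‖ := h1
    _ ≤ (B * 4 ^ n) ^ s * (Real.sqrt (1 + c⁻¹) * (1 / Real.sqrt 2) ^ n * ‖u‖) := by
      gcongr
      exact volume_dyadicShell_le n
    _ = B ^ s * Real.sqrt (1 + c⁻¹) * ρ ^ n * ‖u‖ := by
      rw [Real.mul_rpow hB0 (by positivity), ← Real.rpow_natCast, ← Real.rpow_mul (by norm_num),
        mul_comm (n : ℝ), Real.rpow_mul (by norm_num), Real.rpow_natCast, hρ,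
        div_eq_mul_one_div ((4 : ℝ) ^ s), mul_pow]
      ring

/-- Convergence of the low-frequency parts to the function itself. -/
theorem tendsto_cutoff_lowFreq (u : EnergySpace 𝕜 c hc) :
    Tendsto (fun n => cutoff (measurableSet_lowFreq n) (fourierL2 u)) atTop
      (𝓝 (fourierL2 u)) := by
  rw [tendsto_iff_norm_sub_tendsto_zero]
  have hlim : Tendsto (fun n : ℕ => Real.sqrt ((1 + c⁻¹) * ‖u‖ ^ 2 * (1 / 2) ^ n)) atTop (𝓝 0) := by
    have h := (tendsto_pow_atTop_nhds_zero_of_lt_one (r := (1 / 2 : ℝ)) (by norm_num)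
      (by norm_num)).const_mul ((1 + c⁻¹) * ‖u‖ ^ 2)
    rw [mul_zero] at h
    have h' := (Real.continuous_sqrt.tendsto 0).comp h
    rwa [Real.sqrt_zero] at h'
  refine squeeze_zero (fun n => norm_nonneg _) (fun n => ?_) hlim
  -- The error is the high-frequency part, where `1 + ‖ζ‖ ≥ 2^n`.
  have h := norm_cutoff_fourierL2_le (measurableSet_lowFreq n).compl
    (fun ζ (hζ : ζ ∈ (lowFreq n)ᶜ) => not_lt.1 hζ) u
  have e : ‖cutoff (measurableSet_lowFreq n) (fourierL2 u) - fourierL2 u‖ =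
      ‖cutoff (measurableSet_lowFreq n).compl (fourierL2 u)‖ := by
    rw [norm_sub_rev]
    congr 1
    refine Lp.ext ?_
    filter_upwards [Lp.coeFn_sub (fourierL2 u) (cutoff (measurableSet_lowFreq n) (fourierL2 u)),
      coeFn_cutoff (measurableSet_lowFreq n) (fourierL2 u),
      coeFn_cutoff (measurableSet_lowFreq n).compl (fourierL2 u)] with ζ h1 h2 h3
    rw [h1, Pi.sub_apply, h2, h3, Set.indicator_compl]
    rfl
  rw [e]
  refine Real.le_sqrt_of_sq_le ?_
  rw [one_div, inv_pow, ← div_eq_mul_inv, le_div_iff₀ (by positivity), mul_comm]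
  exact h

/-- The energy space embeds compactly into `L^q(K)`. -/
theorem exists_isCompactOperator_ae_eq (hq : 2 ≤ q) (hq' : q < 4) (hμ : μ ≤ volume)
    {K : Set Plane} (hK : IsCompact K) (hμK : ∀ᵐ x ∂μ, x ∈ K) :
    ∃ T : EnergySpace 𝕜 c hc →L[ℝ] Lp ℂ q μ, IsCompactOperator T ∧
      ∀ u, T u =ᵐ[μ] toComplex 𝕜 u.toL2 := by
  have hsum := (summable_norm_dyadicPiece (𝕜 := 𝕜) (hc := hc) hq hq' hμ).of_norm
  have hT := hsum.hasSum.tendsto_sum_nat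
  -- Compact operators are closed under operator-norm limits, so the sum of the series is the
  -- required `T`.
  refine ⟨_, isCompactOperator_of_tendsto hT (Eventually.of_forall fun n => ?_), fun u => ?_⟩
  · exact Submodule.sum_mem (compactOperator (RingHom.id ℝ) (EnergySpace 𝕜 c hc) (Lp ℂ q μ))
      fun i _ => isCompactOperator_dyadicPiece hK hμK i
  · have h1 : Tendsto (fun n => bandLp q μ (measurableSet_lowFreq n) (volume_lowFreq_ne_top n)
        (fourierL2 u)) atTop (𝓝 ((∑' n, dyadicPiece q μ n) u)) := by
      have := ((ContinuousLinearMap.apply ℝ (Lp ℂ q μ) u).continuous.tendsto _).comp hT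
      refine this.congr fun n => ?_
      rw [← sum_dyadicPiece]
      simp
    have h2 : Tendsto (fun n => (𝓕⁻ (cutoff (measurableSet_lowFreq n) (fourierL2 u)) :
        Lp ℂ 2 (volume : Measure Plane))) atTop (𝓝 (toComplex 𝕜 u.toL2)) := by
      rw [← fourierInv_fourierL2]
      exact ((Lp.fourierTransformₗᵢ Plane ℂ).symm.continuous.tendsto _).comp
        (tendsto_cutoff_lowFreq u)
    -- The low-frequency parts converge to `T u` in `L^q(μ)` and to `u` in `L²`. Both convergences
    -- hold in `μ`-measure, where limits are a.e. unique.
    have m1 := tendstoInMeasure_of_tendsto_Lp h1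
    have m2 := tendstoInMeasure_mono_measure hμ (tendstoInMeasure_of_tendsto_Lp h2)
    refine tendstoInMeasure_ae_unique (m1.congr_left fun n => ?_) m2
    filter_upwards [bandLp_ae_eq (q := q) (μ := μ) (measurableSet_lowFreq n)
      (volume_lowFreq_ne_top n) (fourierL2 u), hμ.absolutelyContinuous.ae_le (band_ae_eq
        (measurableSet_lowFreq n) (volume_lowFreq_ne_top n) (fourierL2 u))] with x h3 h4
    rw [h3, h4]

end

end EnergySpace

/-! ### `L^q_loc` as a closed subspace of the product of the `L^q(K)`. -/

namespace LpLoc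

variable {𝕜 : Type*} [RCLike 𝕜] {q : ℝ≥0∞}

theorem restrict_ae_eq (f : LpLoc 𝕜 q) (K : {K : Set Plane // IsCompact K}) :
    restrict K f =ᵐ[volume.restrict K] f.toAEEqFun :=
  MemLp.coeFn_toLp ((toSubmodule f).2 K K.2)

/-- A compatible family of `L^q` functions on the compact sets glues to an `L^q_loc` function. -/
theorem exists_restrict_eq
    (F : ∀ K : {K : Set Plane // IsCompact K}, Lp 𝕜 q (volume.restrict (K : Set Plane)))
    (hF : ∀ K L : {K : Set Plane // IsCompact K}, (K : Set Plane) ⊆ L →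
      F K =ᵐ[volume.restrict (K : Set Plane)] F L) :
    ∃ f : LpLoc 𝕜 q, ∀ K, restrict K f = F K := by
  set B : ℕ → {K : Set Plane // IsCompact K} := fun n =>
    ⟨Metric.closedBall 0 n, isCompact_closedBall _ _⟩
  have hBm : ∀ n, MeasurableSet (B n : Set Plane) := fun n => measurableSet_closedBall
  -- At each `x`, use the smallest ball of natural radius containing it. The radius varies with `x`,
  -- but countably many balls give only countably many exceptional null sets.
  set f : Plane → 𝕜 := fun x => F (B ⌈‖x‖⌉₊) x with hf
  have hfB : ∀ N, f =ᵐ[volume.restrict (B N : Set Plane)] F (B N) := fun N => by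
    have h : ∀ᵐ x : Plane, ∀ n ≤ N, x ∈ (B n : Set Plane) → F (B n) x = F (B N) x := by
      rw [ae_all_iff]
      intro n
      by_cases hn : n ≤ N
      · filter_upwards [(ae_restrict_iff' (hBm n)).1
          (hF (B n) (B N) (Metric.closedBall_subset_closedBall (by exact_mod_cast hn)))]
          with x hx _ using hx
      · exact Eventually.of_forall fun x h => absurd h hn
    refine (ae_restrict_iff' (hBm N)).2 ?_
    filter_upwards [h] with x hx hxN
    refine hx _ (Nat.ceil_le.2 (mem_closedBall_zero_iff.1 hxN)) ?_
    exact mem_closedBall_zero_iff.2 (Nat.le_ceil _)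
  have hfm : AEStronglyMeasurable f volume := by
    have hU : ⋃ N, (B N : Set Plane) = Set.univ := Metric.iUnion_closedBall_nat 0
    rw [← Measure.restrict_univ (μ := volume), ← hU, aestronglyMeasurable_iUnion_iff]
    exact fun N => (Lp.aestronglyMeasurable (F (B N))).congr (hfB N).symm
  have hfK : ∀ K : {K : Set Plane // IsCompact K},
      (AEEqFun.mk f hfm : Plane →ₘ[volume] 𝕜) =ᵐ[volume.restrict (K : Set Plane)] F K :=
    fun K => by
      obtain ⟨r, hr⟩ := K.2.isBounded.subset_closedBall (0 : Plane)
      obtain ⟨N, hN⟩ := exists_nat_ge r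
      have hKN : (K : Set Plane) ⊆ B N := hr.trans (Metric.closedBall_subset_closedBall hN)
      have h1 : f =ᵐ[volume.restrict (K : Set Plane)] F (B N) :=
        ae_restrict_of_ae_restrict_of_subset hKN (hfB N)
      have h2 : (AEEqFun.mk f hfm : Plane →ₘ[volume] 𝕜) =ᵐ[volume.restrict (K : Set Plane)] f :=
        ae_restrict_of_ae (AEEqFun.coeFn_mk f hfm)
      exact h2.trans (h1.trans (hF K (B N) hKN).symm)
  refine ⟨toSubmodule.symm ⟨AEEqFun.mk f hfm,
    fun K hK => (Lp.memLp (F ⟨K, hK⟩)).ae_eq (hfK ⟨K, hK⟩).symm⟩, fun K => ?_⟩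
  exact Lp.ext ((restrict_ae_eq _ K).trans (hfK K))

variable [Fact (1 ≤ q)]

/-- The restrictions to all compact sets. -/
def restrictAll (f : LpLoc 𝕜 q) (K : {K : Set Plane // IsCompact K}) :
    Lp 𝕜 q (volume.restrict (K : Set Plane)) := restrict K f

theorem isInducing_restrictAll : IsInducing (restrictAll (𝕜 := 𝕜) (q := q)) :=
  inducing_iInf_to_pi _

/-- By gluing, the range consists of the compatible families, and each compatibility condition is
closed because `L^q` limits are limits in measure. -/
theorem isClosed_range_restrictAll : IsClosed (Set.range (restrictAll (𝕜 := 𝕜) (q := q))) := by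
  have h : Set.range (restrictAll (𝕜 := 𝕜) (q := q)) =
      ⋂ (K : {K : Set Plane // IsCompact K}) (L : {K : Set Plane // IsCompact K})
        (_ : (K : Set Plane) ⊆ L), {F | F K =ᵐ[volume.restrict (K : Set Plane)] F L} := by
    ext F
    simp only [Set.mem_iInter, Set.mem_ofPred_eq]
    constructor
    · rintro ⟨f, rfl⟩ K L hKL
      have h1 : f.toAEEqFun =ᵐ[volume.restrict (K : Set Plane)] restrict L f :=
        ae_restrict_of_ae_restrict_of_subset hKL (restrict_ae_eq f L).symm
      exact (restrict_ae_eq f K).trans h1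
    · intro hF
      obtain ⟨f, hf⟩ := exists_restrict_eq F hF
      exact ⟨f, funext hf⟩
  rw [h]
  refine isClosed_iInter fun K => isClosed_iInter fun L => isClosed_iInter fun hKL => ?_
  have hc : IsClosed {ab : Lp 𝕜 q (volume.restrict (K : Set Plane)) ×
      Lp 𝕜 q (volume.restrict (L : Set Plane)) |
        ab.1 =ᵐ[volume.restrict (K : Set Plane)] ab.2} := by
    refine IsSeqClosed.isClosed fun s ab hs hab => ?_
    have h1 := tendstoInMeasure_of_tendsto_Lp ((continuous_fst.tendsto _).comp hab)
    have h2 := tendstoInMeasure_mono_measure (Measure.restrict_mono_set volume hKL)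
      (tendstoInMeasure_of_tendsto_Lp ((continuous_snd.tendsto _).comp hab))
    exact tendstoInMeasure_ae_unique (h1.congr_left hs) h2
  have hcont : Continuous fun F : ∀ K : {K : Set Plane // IsCompact K},
      Lp 𝕜 q (volume.restrict (K : Set Plane)) => (F K, F L) :=
    (continuous_apply K).prodMk (continuous_apply L)
  exact hc.preimage hcont

theorem continuous_iff_restrict {X : Type*} [TopologicalSpace X] {T : X → LpLoc 𝕜 q} :
    Continuous T ↔ ∀ K, Continuous fun x => restrict K (T x) := by
  rw [isInducing_restrictAll.continuous_iff, continuous_pi_iff]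
  rfl

/-- A linear map into `L^q_loc` is compact if all its restrictions to compact sets are. -/
theorem isCompactOperator_of_restrict {E : Type*} [SeminormedAddCommGroup E] [NormedSpace ℝ E]
    {T : E →ₗ[ℝ] LpLoc 𝕜 q} (h : ∀ K, IsCompactOperator (restrict K ∘ₗ T)) :
    IsCompactOperator T := by
  choose S hS hTS using fun K => (h K).image_closedBall_subset_compact 1
  -- The product of the compact sets `S K` is compact by Tychonoff; its preimage under an inducing
  -- map with closed range is compact too.
  refine ⟨restrictAll ⁻¹' Set.univ.pi S,
    isInducing_restrictAll.isCompact_preimage isClosed_range_restrictAll (isCompact_univ_pi hS),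
    mem_of_superset (Metric.closedBall_mem_nhds 0 zero_lt_one) fun u hu K _ => ?_⟩
  exact hTS K ⟨u, hu, rfl⟩

end LpLoc

/-! ### The inclusion into `L^q_loc`. -/

namespace EnergySpace

variable {𝕜 : Type*} [RCLike 𝕜] {c : ℝ} {hc : 0 < c} {q : ℝ≥0∞} [Fact (1 ≤ q)]

/-- Returns from complex to `𝕜`-valued functions by composing with `RCLike.map ℂ 𝕜`, a continuous
left inverse of `RCLike.map 𝕜 ℂ`. -/
theorem exists_isCompactOperator_restrict (hq : 2 ≤ q) (hq' : q < 4)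
    (K : {K : Set Plane // IsCompact K}) :
    ∃ T : EnergySpace 𝕜 c hc →L[ℝ] Lp 𝕜 q (volume.restrict (K : Set Plane)),
      IsCompactOperator T ∧ ∀ u, T u =ᵐ[volume.restrict (K : Set Plane)] u.toL2 := by
  have : IsFiniteMeasure (volume.restrict (K : Set Plane)) :=
    ⟨by simpa using K.2.measure_lt_top⟩
  obtain ⟨T, hT, hTu⟩ := exists_isCompactOperator_ae_eq (𝕜 := 𝕜) (hc := hc) hq hq'
    (Measure.restrict_le_self (s := (K : Set Plane))) K.2
    (ae_restrict_mem K.2.isClosed.measurableSet)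
  refine ⟨(RCLike.map ℂ 𝕜).compLpL q _ ∘L T,
    hT.clm_comp ((RCLike.map ℂ 𝕜).compLpL q (volume.restrict (K : Set Plane))), fun u => ?_⟩
  filter_upwards [(RCLike.map ℂ 𝕜).coeFn_compLpL (T u), hTu u,
    ae_restrict_of_ae (coeFn_toComplex u.toL2)] with x h1 h2 h3
  rw [ContinuousLinearMap.comp_apply, h1, h2, h3, rclike_map_map]

/-- The inclusion of the energy space into `L^q_loc`, as a linear map. -/
def toLpLoc (hq : 2 ≤ q) (hq' : q < 4) : EnergySpace 𝕜 c hc →ₗ[ℝ] LpLoc 𝕜 q where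
  toFun u := LpLoc.toSubmodule.symm ⟨(u.toL2 : Plane →ₘ[volume] 𝕜), fun K hK => by
    -- Local integrability of `u` comes from its a.e. equality on `K` with `T u`, which lies in
    -- `L^q(K)`.
    obtain ⟨T, -, hT⟩ := exists_isCompactOperator_restrict (𝕜 := 𝕜) (hc := hc) hq hq' ⟨K, hK⟩
    exact (Lp.memLp (T u)).ae_eq (hT u)⟩
  map_add' _ _ := rfl
  map_smul' _ _ := rfl

theorem toLpLoc_toAEEqFun (hq : 2 ≤ q) (hq' : q < 4) (u : EnergySpace 𝕜 c hc) :
    (toLpLoc hq hq' u).toAEEqFun = (u.toL2 : Plane →ₘ[volume] 𝕜) := rfl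

theorem toLpLoc_injective (hq : 2 ≤ q) (hq' : q < 4) :
    Function.Injective (toLpLoc (𝕜 := 𝕜) (hc := hc) hq hq') := fun u v h => by
  have h' := congrArg LpLoc.toAEEqFun h
  exact toSubmodule.injective (Subtype.ext (Subtype.ext h'))

theorem exists_restrict_toLpLoc (hq : 2 ≤ q) (hq' : q < 4)
    (K : {K : Set Plane // IsCompact K}) :
    ∃ T : EnergySpace 𝕜 c hc →L[ℝ] Lp 𝕜 q (volume.restrict (K : Set Plane)),
      IsCompactOperator T ∧ ∀ u, LpLoc.restrict K (toLpLoc hq hq' u) = T u := by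
  obtain ⟨T, hTc, hT⟩ := exists_isCompactOperator_restrict (𝕜 := 𝕜) (hc := hc) hq hq' K
  exact ⟨T, hTc, fun u => Lp.ext ((LpLoc.restrict_ae_eq _ K).trans (hT u).symm)⟩

theorem continuous_toLpLoc (hq : 2 ≤ q) (hq' : q < 4) :
    Continuous (toLpLoc (𝕜 := 𝕜) (hc := hc) hq hq') := by
  refine LpLoc.continuous_iff_restrict.2 fun K => ?_
  obtain ⟨T, -, hT⟩ := exists_restrict_toLpLoc (𝕜 := 𝕜) (hc := hc) hq hq' K
  exact T.continuous.congr fun u => (hT u).symm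

theorem isCompactOperator_toLpLoc (hq : 2 ≤ q) (hq' : q < 4) :
    IsCompactOperator (toLpLoc (𝕜 := 𝕜) (hc := hc) hq hq') := by
  refine LpLoc.isCompactOperator_of_restrict fun K => ?_
  obtain ⟨T, hTc, hT⟩ := exists_restrict_toLpLoc (𝕜 := 𝕜) (hc := hc) hq hq' K
  have : ⇑(LpLoc.restrict K ∘ₗ toLpLoc (𝕜 := 𝕜) (hc := hc) hq hq') = T := funext hT
  rwa [this]

end EnergySpace

end ShriraSpace

end

theorem lemma2p3 (𝕜 : Type*) [RCLike 𝕜] (c : ℝ) (hc : 0 < c) (p : ℝ) (hp0 : 0 ≤ p) (hp2 : p < 2) :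
    ∃ ι : ShriraSpace.EnergySpace 𝕜 c hc →L[ℝ] ShriraSpace.LpLoc 𝕜 (ENNReal.ofReal p + 2),
      (∀ u : ShriraSpace.EnergySpace 𝕜 c hc, (ι u).toAEEqFun = (u.toL2 : _ →ₘ[_] 𝕜)) ∧
      Function.Injective ι ∧ IsCompactOperator ι := by
  have hq : (2 : ℝ≥0∞) ≤ ENNReal.ofReal p + 2 := le_add_self
  have hq' : ENNReal.ofReal p + 2 < 4 := by
    have h : ENNReal.ofReal p < 2 := (ENNReal.ofReal_lt_ofNat).2 hp2
    calc ENNReal.ofReal p + 2 < 2 + 2 := ENNReal.add_lt_add_right (by simp) h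
      _ = 4 := by norm_num
  exact ⟨⟨ShriraSpace.EnergySpace.toLpLoc hq hq',
    ShriraSpace.EnergySpace.continuous_toLpLoc hq hq'⟩,
    ShriraSpace.EnergySpace.toLpLoc_toAEEqFun hq hq',
    ShriraSpace.EnergySpace.toLpLoc_injective hq hq',
    ShriraSpace.EnergySpace.isCompactOperator_toLpLoc hq hq'⟩
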